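/- Let $(\Omega,\Sigma,P)$ be a probability space, let $(\Upsilon,T)$ be a measurable space whose $\sigma$-algebra $T$ is countably generated, and let $\{X_i\}_{i\in I}$ be an infinite family of $\Sigma$-$T$-measurable maps from $\Omega$ into $\Upsilon$. Suppose that the family is $P$-exchangeable, i.e. for each $r\in\mathbb{N}$, $$P\Bigl(\bigcap_{k=1}^{r}X_{i_k}^{-1}(B_k)\Bigr)=P\Bigl(\bigcap_{k=1}^{r}X_{j_k}^{-1}(B_k)\Bigr)$$ whenever $i_1,\dots,i_r\in I$ are distinct, $j_1,\dots,j_r\in I$ are distinct and $B_1,\dots,B_r\in T$. Suppose also that for each $i\in I$ the distribution $P_{X_i}=P\circ X_i^{-1}$ on $T$ is perfect, i.e. for every $T$-measurable $f:\Upsilon\to\mathbb{R}$ there is a Borel set $B\subseteq f(\Upsilon)$ with $P_{X_i}(f^{-1}(B))=1$. Then for every integer $d\ge 1$ there exists a map $\Theta:\Omega\to\mathbb{R}^d$, measurable with respect to $\Sigma$ and the Borel $\sigma$-algebra of $\mathbb{R}^d$, such that $\{X_i\}_{i\in I}$ is $P$-conditionally i.i.d. given $\Theta$, i.e. such that with $\mathcal{F}:=\sigma(\Theta)$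 the following two conditions hold. (1) Conditional independence: for all $n\ge 2$, all distinct $i_1,\dots,i_n\in I$ and all $E_j\in\sigma(X_{i_j})$ $(1\le j\le n)$, $$P(E_1\cap\dots\cap E_n\mid\mathcal{F})=\prod_{j=1}^{n}P(E_j\mid\mathcal{F})\quad P\text{-a.s.}$$ (2) Conditional identical distribution: $P(F\cap X_i^{-1}(B))=P(F\cap X_j^{-1}(B))$ for all $i,j\in I$, $F\in\mathcal{F}$ and $B\in T$. -/

import Mathlib

open MeasureTheory ProbabilityTheory

/-- A probability measure `μ` is perfect if for every real random variable `f` there is a Borel set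
`B` contained in the range of `f` with `μ (f ⁻¹' B) = 1`. -/
def IsPerfectMeasure {α : Type*} [MeasurableSpace α] (μ : Measure α) : Prop :=
  ∀ f : α → ℝ, Measurable f →
    ∃ B : Set ℝ, MeasurableSet B ∧ B ⊆ Set.range f ∧ μ (f ⁻¹' B) = 1

/-- Exchangeability of a family of maps: the joint law of `r` members of the family with distinct
indices, evaluated on measurable rectangles, does not depend on the choice of the indices. -/
def IsExchangeable {Ω Y I : Type*} [MeasurableSpace Ω] [MeasurableSpace Y]
    (X : I → Ω → Y) (P : Measure Ω) : Prop :=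
  ∀ (r : ℕ) (i j : Fin r → I), Function.Injective i → Function.Injective j →
    ∀ B : Fin r → Set Y, (∀ k, MeasurableSet (B k)) →
      P (⋂ k, X (i k) ⁻¹' B k) = P (⋂ k, X (j k) ⁻¹' B k)

/-- Conditional independence over `F` of a family `S` of sub-σ-algebras:
for distinct indices `i 1, …, i n` (`2 ≤ n`) and events `E j` in `S (i j)`,
`P(E 1 ∩ ⋯ ∩ E n | F) = ∏ j, P(E j | F)` almost surely. Mathlib's `iCondIndep` is not used since it
requires `Ω` to be a standard Borel space. -/
def IsCondIndepOver {Ω I : Type*} (F : MeasurableSpace Ω) [mΩ : MeasurableSpace Ω]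
    (S : I → MeasurableSpace Ω) (P : Measure Ω) : Prop :=
  ∀ n : ℕ, 2 ≤ n → ∀ i : Fin n → I, Function.Injective i →
    ∀ E : Fin n → Set Ω, (∀ j, MeasurableSet[S (i j)] (E j)) →
      P⟦⋂ j, E j | F⟧ =ᵐ[P] ∏ j, P⟦E j | F⟧

/-- Conditional independence over `F` of a family of maps: the generated σ-algebras are
conditionally independent over `F`. -/
def IsCondIndepFunOver {Ω Y I : Type*} (F : MeasurableSpace Ω) [mΩ : MeasurableSpace Ω]
    [mY : MeasurableSpace Y] (X : I → Ω → Y) (P : Measure Ω) : Prop :=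
  IsCondIndepOver F (fun i => mY.comap (X i)) P

/-- Conditional identical distribution over `F` of a family of maps. -/
def IsCondIdentDistribOver {Ω Y I : Type*} (F : MeasurableSpace Ω) [mΩ : MeasurableSpace Ω]
    [MeasurableSpace Y] (X : I → Ω → Y) (P : Measure Ω) : Prop :=
  ∀ i j : I, ∀ A : Set Ω, MeasurableSet[F] A → ∀ B : Set Y, MeasurableSet B →
    P (A ∩ X i ⁻¹' B) = P (A ∩ X j ⁻¹' B)

/-- The family `X` is conditionally i.i.d. given `Θ`, i.e. over the σ-algebra generated by `Θ`. -/
def IsCondIIDGiven {Ω Y I Ψ : Type*} [MeasurableSpace Ω] [MeasurableSpace Y]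
    [mΨ : MeasurableSpace Ψ] (Θ : Ω → Ψ) (X : I → Ω → Y) (P : Measure Ω) : Prop :=
  IsCondIndepFunOver (mΨ.comap Θ) X P ∧ IsCondIdentDistribOver (mΨ.comap Θ) X P

/-! Fix an injective index sequence `s` and a countable π-system of sets `A m` generating the
σ-algebra of `Y`. By exchangeability, a single function `h m` of the later observations gives P(X (t
0) ∈ A m | X (t 1), X (t 2), …) for every injective `t`. Deleting X (t 1) does not change its value:
the value after deletion is the conditional expectation of the value before it on a smaller
σ-algebra, and both have the same law, hence the same second moment, so they agree a.s.
(`comp_samplePath_succ_ae_eq`). Hence the statistic V = (h m)ₘ along `s` is a.s. the same along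
every injective sequence sharing a tail with `s`.

Given a finite J and j ∉ J, use such a sequence that starts at j and meets J later. V is then a
function of the later observations, so V m is a version of P(X j ∈ A m | V, X i for i ∈ J). It does
not involve J, which is conditional independence for the sets `A m`; a π-λ argument and induction
give the rest. The law of (V, X j) is read off the law of a path starting at j, so it does not
depend on j. Finally V takes values in a standard Borel space, so a random vector generates the same
σ-algebra. -/

/-! ### An L² criterion for equality with a conditional expectation. -/

/-- A square integrable function with the same second moment as its conditional expectation is
equal to the latter. -/
theorem ae_eq_of_condExp_ae_eq_of_integral_mul_self_eq {Ω : Type*} {m mΩ : MeasurableSpace Ω}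
    {P : Measure Ω} [IsFiniteMeasure P] (hm : m ≤ mΩ) {f g : Ω → ℝ} (hf : Integrable f P)
    (hff : Integrable (f * f) P) (hfg : Integrable (f * g) P) (hgg : Integrable (g * g) P)
    (hg : StronglyMeasurable[m] g) (h : P[f | m] =ᵐ[P] g)
    (hsq : ∫ ω, (f * f) ω ∂P = ∫ ω, (g * g) ω ∂P) : f =ᵐ[P] g := by
  -- f - g is orthogonal to the `m`-measurable g; with equal second moments this forces E(f - g)² =
  -- 0.
  have hcross : ∫ ω, (f * g) ω ∂P = ∫ ω, (g * g) ω ∂P := by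
    rw [← integral_condExp hm]
    refine integral_congr_ae ((condExp_mul_of_stronglyMeasurable_right hg hfg hf).trans ?_)
    filter_upwards [h] with ω hω
    simp [hω]
  have hexp : (fun ω => (f ω - g ω) ^ 2) = f * f - (f * g + f * g) + g * g := by
    ext ω
    simp only [Pi.add_apply, Pi.sub_apply, Pi.mul_apply]
    ring
  have hzero : ∫ ω, (f ω - g ω) ^ 2 ∂P = 0 := by
    rw [hexp, integral_add' (hff.sub (hfg.add hfg)) hgg, integral_sub' hff (hfg.add hfg),
      integral_add' hfg hfg, hcross, hsq]
    ring
  rw [integral_eq_zero_iff_of_nonneg (fun ω => sq_nonneg _)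
    (hexp ▸ (hff.sub (hfg.add hfg)).add hgg)] at hzero
  filter_upwards [hzero] with ω hω
  exact sub_eq_zero.mp (pow_eq_zero_iff two_ne_zero |>.mp hω)

/-! ### Sample paths and conditional probabilities given the later observations. -/

section SamplePath

variable {Ω Y I : Type*}

/-- The sequence of observations of the family `X` along the sequence `t` of indices. -/
def samplePath (X : I → Ω → Y) (t : ℕ → I) (ω : Ω) : ℕ → Y := fun k => X (t k) ω

variable [MeasurableSpace Ω] [MeasurableSpace Y] {P : Measure Ω} {X : I → Ω → Y}

theorem measurable_samplePath (hX : ∀ i, Measurable (X i)) (t : ℕ → I) :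
    Measurable (samplePath X t) :=
  measurable_pi_lambda _ fun k => hX (t k)

theorem IsExchangeable.map_samplePath_eq [IsProbabilityMeasure P] (hexch : IsExchangeable X P)
    (hX : ∀ i, Measurable (X i)) {t t' : ℕ → I} (ht : t.Injective) (ht' : t'.Injective) :
    P.map (samplePath X t) = P.map (samplePath X t') := by
  have hm := measurable_samplePath hX
  have : IsProbabilityMeasure (P.map (samplePath X t)) :=
    Measure.isProbabilityMeasure_map (hm t).aemeasurable
  have : IsProbabilityMeasure (P.map (samplePath X t')) :=
    Measure.isProbabilityMeasure_map (hm t').aemeasurable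
  refine ext_of_generate_finite _ generateFrom_squareCylinders.symm
    (isPiSystem_squareCylinders (fun _ => MeasurableSpace.isPiSystem_measurableSet) (by simp))
    ?_ (by simp)
  rintro _ ⟨s, B, hB, rfl⟩
  have hB' : ∀ k, MeasurableSet (B k) := fun k => hB k (Set.mem_univ k)
  have hS : MeasurableSet ((s : Set ℕ).pi B) :=
    MeasurableSet.pi s.countable_toSet fun k _ => hB' k
  -- Enumerating the finite base of the cylinder turns it into a rectangle as in `IsExchangeable`.
  let e := s.equivFin.symm
  have key : ∀ u : ℕ → I, samplePath X u ⁻¹' (s : Set ℕ).pi B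
      = ⋂ k, X (u (e k)) ⁻¹' B (e k) := by
    intro u
    ext ω
    simp only [Set.mem_preimage, Set.mem_pi, Set.mem_iInter, samplePath]
    refine ⟨fun h k => h _ (e k).2, fun h k hk => ?_⟩
    have := h (e.symm ⟨k, hk⟩)
    rwa [e.apply_symm_apply] at this
  rw [Measure.map_apply (hm t) hS, Measure.map_apply (hm t') hS, key, key]
  exact hexch _ (fun k => t (e k)) (fun k => t' (e k))
    (ht.comp (Subtype.val_injective.comp e.injective))
    (ht'.comp (Subtype.val_injective.comp e.injective)) _ fun k => hB' _

theorem setIntegral_indicator_one_eq_measureReal {E G : Set Ω}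
    (hE : MeasurableSet E) :
    ∫ ω in G, E.indicator (fun _ => (1 : ℝ)) ω ∂P = P.real (E ∩ G) := by
  rw [setIntegral_indicator hE, setIntegral_const, Set.inter_comm]
  simp

/-- The function `h` of a sequence of observations is a common version of the conditional
probabilities that the first observation along an injective sequence of indices lies in `A`, given
all later observations. -/
structure IsTailCondProb (X : I → Ω → Y) (P : Measure Ω) (A : Set Y) (h : (ℕ → Y) → ℝ) : Prop where
  measurable : Measurable h
  mem_Icc : ∀ y, h y ∈ Set.Icc 0 1
  ae_eq : ∀ t : ℕ → I, t.Injective →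
    h ∘ samplePath X (fun k => t (k + 1)) =ᵐ[P]
      P⟦X (t 0) ⁻¹' A | MeasurableSpace.comap (samplePath X fun k => t (k + 1)) inferInstance⟧

theorem IsTailCondProb.norm_le_one {A : Set Y} {h : (ℕ → Y) → ℝ} (H : IsTailCondProb X P A h)
    (y : ℕ → Y) : ‖h y‖ ≤ 1 := by
  rw [Real.norm_eq_abs, abs_of_nonneg (H.mem_Icc _).1]
  exact (H.mem_Icc _).2

theorem IsTailCondProb.integrable_comp [IsFiniteMeasure P] (hX : ∀ i, Measurable (X i))
    {A : Set Y} {h : (ℕ → Y) → ℝ} (H : IsTailCondProb X P A h) (u : ℕ → I) :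
    Integrable (h ∘ samplePath X u) P :=
  Integrable.of_bound (H.measurable.comp (measurable_samplePath hX u)).aestronglyMeasurable 1
    (ae_of_all _ fun _ => H.norm_le_one _)

/-- The conditional probability that the first observation along an injective sequence of indices
lies in `A`, given all later observations, is a function of the later observations that does not
depend on the sequence of indices. -/
theorem IsExchangeable.exists_condExp_eq_comp_samplePath [IsProbabilityMeasure P] [Infinite I]
    (hexch : IsExchangeable X P) (hX : ∀ i, Measurable (X i)) {A : Set Y} (hA : MeasurableSet A) :
    ∃ h : (ℕ → Y) → ℝ, IsTailCondProb X P A h := by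
  have hm := measurable_samplePath hX
  obtain ⟨s, hs⟩ : ∃ s : ℕ → I, s.Injective :=
    ⟨Infinite.natEmbedding I, (Infinite.natEmbedding I).injective⟩
  have hind : ∀ i, Integrable ((X i ⁻¹' A).indicator fun _ => (1 : ℝ)) P := fun i =>
    (integrable_const 1).indicator (hX i hA)
  obtain ⟨h₀, hh₀, hc⟩ := (stronglyMeasurable_condExp (μ := P)
    (f := (X (s 0) ⁻¹' A).indicator fun _ => (1 : ℝ))
    (m := MeasurableSpace.comap (samplePath X fun k => s (k + 1))
      inferInstance)).exists_eq_measurable_comp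
  have h0 : 0 ≤ᵐ[P] h₀ ∘ samplePath X fun k => s (k + 1) := by
    rw [← hc]
    exact condExp_nonneg (ae_of_all _ fun ω => Set.indicator_nonneg (by simp) ω)
  have h1 : h₀ ∘ (samplePath X fun k => s (k + 1)) ≤ᵐ[P] fun _ => 1 := by
    rw [← hc]
    have := condExp_mono (μ := P) (m := MeasurableSpace.comap (samplePath X fun k => s (k + 1))
      inferInstance) (hind (s 0)) (integrable_const 1)
      (ae_of_all _ fun ω => Set.indicator_le_self' (by simp) ω)
    rwa [condExp_const (hm _).comap_le] at this
  -- `h₀` lies in [0, 1] only along almost every path of `s`; clamping gives the bound everywhere,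
  -- hence integrability along every sequence.
  let h : (ℕ → Y) → ℝ := fun y => max 0 (min 1 (h₀ y))
  have hh : Measurable h := measurable_const.max (measurable_const.min hh₀.measurable)
  have hb : ∀ y, h y ∈ Set.Icc 0 1 := fun y =>
    ⟨le_max_left _ _, max_le zero_le_one (min_le_left _ _)⟩
  have hs' : h ∘ samplePath X (fun k => s (k + 1)) =ᵐ[P]
      P⟦X (s 0) ⁻¹' A | MeasurableSpace.comap (samplePath X fun k => s (k + 1)) inferInstance⟧ := by
    rw [hc]
    filter_upwards [h0, h1] with ω h0 h1
    simp only [Function.comp_apply, Pi.zero_apply] at h0 h1 ⊢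
    simp [h, h0, h1]
  refine ⟨h, ⟨hh, hb, fun t ht => ?_⟩⟩
  let g : (ℕ → Y) → ℝ := fun y => h fun k => y (k + 1)
  have htail : Measurable fun (y : ℕ → Y) (k : ℕ) => y (k + 1) :=
    measurable_pi_lambda _ fun k => measurable_pi_apply _
  have hg : Measurable g := hh.comp htail
  have hbd : ∀ y, ‖h y‖ ≤ 1 := fun y => by
    rw [Real.norm_eq_abs, abs_of_nonneg (hb _).1]; exact (hb _).2
  have hgint : ∀ u : ℕ → I, Integrable (h ∘ samplePath X u) P := fun u =>
    Integrable.of_bound (hh.comp (hm u)).aestronglyMeasurable 1 (ae_of_all _ fun ω => hbd _)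
  have hlaw := hexch.map_samplePath_eq hX ht hs
  have hset : ∀ (u : ℕ → I) (C : Set (ℕ → Y)), MeasurableSet C →
      ∫ ω in samplePath X (fun k => u (k + 1)) ⁻¹' C, h (samplePath X (fun k => u (k + 1)) ω) ∂P =
        ∫ y in (fun (y : ℕ → Y) (k : ℕ) => y (k + 1)) ⁻¹' C, g y ∂(P.map (samplePath X u)) := by
    intro u C hC
    rw [setIntegral_map (htail hC) hg.aestronglyMeasurable (hm u).aemeasurable]
    rfl
  have hreal : ∀ (u : ℕ → I) (C : Set (ℕ → Y)), MeasurableSet C →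
      P.real (X (u 0) ⁻¹' A ∩ samplePath X (fun k => u (k + 1)) ⁻¹' C) =
        (P.map (samplePath X u)).real
          ((fun y => y 0) ⁻¹' A ∩ (fun (y : ℕ → Y) (k : ℕ) => y (k + 1)) ⁻¹' C) := by
    intro u C hC
    rw [map_measureReal_apply (hm u) ((measurable_pi_apply 0 hA).inter (htail hC))]
    rfl
  -- Both sides of the defining identity depend only on the law of the whole path, which is the same
  -- for `t` and `s`.
  refine ae_eq_condExp_of_forall_setIntegral_eq (hm _).comap_le (hind _)
    (fun G _ _ => (hgint _).integrableOn) ?_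
    (hh.stronglyMeasurable.comp_measurable
      (comap_measurable (samplePath X fun k => t (k + 1)))).aestronglyMeasurable
  rintro _ ⟨C, hC, rfl⟩ -
  have e1 := setIntegral_condExp (μ := P) (hm fun k => s (k + 1)).comap_le (hind (s 0))
    ⟨C, hC, rfl⟩
  rw [← setIntegral_congr_ae (hm _ hC) (hs'.mono fun _ hx _ => hx),
    setIntegral_indicator_one_eq_measureReal (hX _ hA)] at e1
  rw [setIntegral_indicator_one_eq_measureReal (hX _ hA), hreal _ _ hC, hlaw, ← hreal _ _ hC, ← e1]
  simp only [Function.comp_apply]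
  rw [hset _ _ hC, hset _ _ hC, hlaw]

/-- A function of the observations whose values along injective sequences are conditional
probabilities of the first observation does not depend on the first remaining observation. -/
theorem IsExchangeable.comp_samplePath_succ_ae_eq [IsProbabilityMeasure P]
    (hexch : IsExchangeable X P) (hX : ∀ i, Measurable (X i)) {A : Set Y}
    {h : (ℕ → Y) → ℝ} (H : IsTailCondProb X P A h)
    {t : ℕ → I} (ht : t.Injective) :
    h ∘ samplePath X (fun k => t (k + 1)) =ᵐ[P] h ∘ samplePath X (fun k => t (k + 2)) := by
  have hm := measurable_samplePath hX
  set f₁ := h ∘ samplePath X (fun k => t (k + 1)) with hf₁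
  set f₂ := h ∘ samplePath X (fun k => t (k + 2)) with hf₂
  have hh := H.measurable
  have hint := H.integrable_comp hX
  have hint2 : ∀ u v : ℕ → I, Integrable ((h ∘ samplePath X u) * (h ∘ samplePath X v)) P :=
    fun u v => (hint v).bdd_mul (hh.comp (hm u)).aestronglyMeasurable (ae_of_all _ fun ω => H.norm_le_one _)
  have hm₁ := (hm fun k => t (k + 1)).comap_le
  have hm₂ := (hm fun k => t (k + 2)).comap_le
  have hle : MeasurableSpace.comap (samplePath X fun k => t (k + 2)) inferInstance ≤
      MeasurableSpace.comap (samplePath X fun k => t (k + 1)) inferInstance := by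
    have : samplePath X (fun k => t (k + 2)) =
        (fun (y : ℕ → Y) (k : ℕ) => y (k + 1)) ∘ samplePath X fun k => t (k + 1) := rfl
    rw [this, ← MeasurableSpace.comap_comp]
    exact MeasurableSpace.comap_mono
      (measurable_pi_lambda _ fun k => measurable_pi_apply _).comap_le
  -- `t` with its term `t 1` deleted: the same observation is predicted, from a path one step
  -- shorter.
  let t' : ℕ → I := fun k => if k = 0 then t 0 else t (k + 1)
  have ht' : t'.Injective := by
    intro a b hab
    simp only [t'] at hab
    split_ifs at hab <;> have := ht hab <;> omega
  have e₂ : f₂ =ᵐ[P] P⟦X (t 0) ⁻¹' A |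
      MeasurableSpace.comap (samplePath X fun k => t (k + 2)) inferInstance⟧ := by
    simpa [t'] using H.ae_eq t' ht'
  have key : ∀ u : ℕ → I, ∫ ω, ((h ∘ samplePath X u) * (h ∘ samplePath X u)) ω ∂P =
      ∫ y, (h * h) y ∂(P.map (samplePath X u)) := fun u => by
    rw [integral_map (hm u).aemeasurable (hh.mul hh).aestronglyMeasurable]
    rfl
  refine ae_eq_of_condExp_ae_eq_of_integral_mul_self_eq hm₂ (hint _) (hint2 _ _) (hint2 _ _)
    (hint2 _ _) (hh.stronglyMeasurable.comp_measurable
      (comap_measurable (samplePath X fun k => t (k + 2))))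
    (((condExp_congr_ae (H.ae_eq t ht)).trans (condExp_condExp_of_le hle hm₁)).trans e₂.symm) ?_
  have hlaw : P.map (samplePath X fun k => t (k + 1)) = P.map (samplePath X fun k => t (k + 2)) :=
    hexch.map_samplePath_eq hX (ht.comp (add_left_injective 1)) (ht.comp (add_left_injective 2))
  rw [hf₁, hf₂, key, key, hlaw]

end SamplePath

/-! ### Rearranging finitely many indices. -/

theorem exists_injective_seq_containing {I : Type*} {s : ℕ → I} (hs : s.Injective)
    (J : Finset I) :
    ∃ t : ℕ → I, t.Injective ∧ (∀ i ∈ J, i ∈ Set.range t) ∧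
      ∃ a b : ℕ, ∀ k, t (k + a) = s (k + b) := by
  classical
  induction J using Finset.induction_on with
  | empty => exact ⟨s, hs, by simp, 0, 0, fun _ => rfl⟩
  | insert i J _ ih =>
    obtain ⟨t, ht, hJ, a, b, hab⟩ := ih
    by_cases hi : i ∈ Set.range t
    · refine ⟨t, ht, fun k hk => ?_, a, b, hab⟩
      obtain rfl | hk := Finset.mem_insert.mp hk
      exacts [hi, hJ k hk]
    · let t' : ℕ → I := fun k => Nat.casesOn k i t
      refine ⟨t', ?_, fun k hk => ?_, a + 1, b, fun k => hab k⟩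
      · rintro (_ | m) (_ | n) h
        · rfl
        · exact absurd ⟨n, h.symm⟩ hi
        · exact absurd ⟨m, h⟩ hi
        · exact congrArg (· + 1) (ht h)
      · obtain rfl | hk := Finset.mem_insert.mp hk
        · exact ⟨0, rfl⟩
        · obtain ⟨n, rfl⟩ := hJ k hk
          exact ⟨n + 1, rfl⟩

/-- An injective sequence may be modified into one that starts with a given term, contains finitely
many other given terms, and has a tail in common with the original sequence. -/
theorem exists_injective_seq_starting_with {I : Type*} {s : ℕ → I} (hs : s.Injective)
    {j : I} {J : Finset I} (hj : j ∉ J) :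
    ∃ t : ℕ → I, t.Injective ∧ t 0 = j ∧ (∀ i ∈ J, ∃ k, t (k + 1) = i) ∧
      ∃ a b : ℕ, ∀ k, t (k + a + 1) = s (k + b + 1) := by
  classical
  obtain ⟨t, ht, hJ, a, b, hab⟩ := exists_injective_seq_containing hs (insert j J)
  obtain ⟨p, hp⟩ := hJ j (Finset.mem_insert_self _ _)
  -- The swap brings `j` to the front; shifting by a further `p` moves the common tail past both
  -- swapped positions.
  refine ⟨t ∘ Equiv.swap 0 p, ht.comp (Equiv.injective _), by simp [hp], fun i hi => ?_,
    a + p, b + p, fun k => ?_⟩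
  · obtain ⟨n, hn⟩ := hJ i (Finset.mem_insert_of_mem hi)
    obtain ⟨m, rfl⟩ := (Equiv.swap 0 p).surjective n
    rcases m with _ | m
    · rw [Equiv.swap_apply_left, hp] at hn
      exact absurd (hn ▸ hi) hj
    · exact ⟨m, hn⟩
  · rw [Function.comp_apply, Equiv.swap_apply_of_ne_of_ne (by omega) (by omega)]
    have := hab (k + p + 1)
    convert this using 2 <;> omega

/-! ### Testing conditional independence by integrals. -/

/-- A π-λ argument: `huniv` makes the integral over `G` itself vanish, which handles complements. -/
theorem setIntegral_preimage_eq_zero_of_generateFrom {Ω Y : Type*} [MeasurableSpace Ω]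
    [mY : MeasurableSpace Y] {P : Measure Ω} {f : Ω → Y} (hf : Measurable f) {u : Ω → ℝ}
    (hu : Integrable u P) {G : Set Ω} (hG : MeasurableSet G) {𝒜 : Set (Set Y)}
    (hgen : mY = MeasurableSpace.generateFrom 𝒜) (hpi : IsPiSystem 𝒜)
    (huniv : Set.univ ∈ 𝒜) (h : ∀ A ∈ 𝒜, ∫ ω in G ∩ f ⁻¹' A, u ω ∂P = 0)
    {B : Set Y} (hB : MeasurableSet B) : ∫ ω in G ∩ f ⁻¹' B, u ω ∂P = 0 := by
  induction B, hB using MeasurableSpace.induction_on_inter hgen hpi with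
  | empty => simp
  | basic A hA => exact h A hA
  | compl A hA ih =>
    have h0 := h _ huniv
    rw [Set.preimage_univ, Set.inter_univ] at h0
    have := integral_inter_add_sdiff (hf hA) (hu.integrableOn (s := G))
    rw [ih, h0, zero_add] at this
    rwa [Set.preimage_compl, ← Set.sdiff_eq]
  | iUnion A hd hA ih =>
    rw [Set.preimage_iUnion, Set.inter_iUnion, integral_iUnion
      (fun i => hG.inter (hf (hA i)))
      (fun i j hij => ((hd hij).preimage f).mono Set.inter_subset_right Set.inter_subset_right)
      hu.integrableOn]
    simp [ih]

/-- Two events are conditionally independent if and only if the deviation of one from its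
conditional probability integrates to zero over the intersections of the other one with events of
the conditioning σ-algebra. -/
theorem condExp_indicator_inter_ae_eq_mul_iff {Ω : Type*} {F mΩ : MeasurableSpace Ω}
    {P : Measure Ω} [IsFiniteMeasure P] (hF : F ≤ mΩ) {D E : Set Ω} (hD : MeasurableSet D)
    (hE : MeasurableSet E) :
    P⟦D ∩ E | F⟧ =ᵐ[P] P⟦D | F⟧ * P⟦E | F⟧ ↔
      ∀ G, MeasurableSet[F] G →
        ∫ ω in G ∩ E, (D.indicator (fun _ => (1 : ℝ)) ω - (P⟦D | F⟧) ω) ∂P = 0 := by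
  have hind : ∀ {S : Set Ω}, MeasurableSet S → Integrable (S.indicator fun _ => (1 : ℝ)) P :=
    fun hS => (integrable_const 1).indicator hS
  have hEv : Integrable (E.indicator (fun _ => (1 : ℝ)) * P⟦D | F⟧) P :=
    integrable_condExp.bdd_mul (c := 1) (hind hE).aestronglyMeasurable
      (ae_of_all _ fun ω => (norm_indicator_le_norm_self _ ω).trans (by simp))
  have hpull : P[E.indicator (fun _ => (1 : ℝ)) * P⟦D | F⟧ | F] =ᵐ[P] P⟦D | F⟧ * P⟦E | F⟧ :=
    (condExp_mul_of_stronglyMeasurable_right stronglyMeasurable_condExp hEv (hind hE)).trans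
      (by rw [mul_comm])
  have hdiff : ∀ G, MeasurableSet[F] G →
      ∫ ω in G ∩ E, (D.indicator (fun _ => (1 : ℝ)) ω - (P⟦D | F⟧) ω) ∂P =
        ∫ ω in G, (P⟦D ∩ E | F⟧) ω ∂P - ∫ ω in G, (P⟦D | F⟧ * P⟦E | F⟧) ω ∂P := by
    intro G hG
    rw [setIntegral_condExp hF (hind (hD.inter hE)) hG,
      ← setIntegral_congr_ae (hF _ hG) (hpull.mono fun _ h _ => h),
      setIntegral_condExp hF hEv hG,
      ← integral_sub (hind (hD.inter hE)).integrableOn hEv.integrableOn, ← setIntegral_indicator hE]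
    congr 1
    ext ω
    by_cases h : ω ∈ E <;> by_cases h' : ω ∈ D <;> simp [h, h']
  have hint : Integrable (P⟦D | F⟧ * P⟦E | F⟧) P := integrable_condExp.congr hpull
  refine ⟨fun h G hG => ?_, fun h => ?_⟩
  · rw [hdiff G hG, setIntegral_congr_ae (hF _ hG) (h.mono fun _ h _ => h), sub_self]
  · exact ae_eq_of_forall_setIntegral_eq_of_sigmaFinite' hF
      (fun _ _ _ => integrable_condExp.integrableOn) (fun _ _ _ => hint.integrableOn)
      (fun G hG _ => sub_eq_zero.mp (by rw [← hdiff G hG, h G hG]))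
      stronglyMeasurable_condExp.aestronglyMeasurable
      (stronglyMeasurable_condExp.mul stronglyMeasurable_condExp).aestronglyMeasurable

/-! ### The tail statistic as a conditioning variable. -/

section TailStatistic

variable {Ω Y I : Type*} [MeasurableSpace Ω] [MeasurableSpace Y] {P : Measure Ω} {X : I → Ω → Y}

theorem IsExchangeable.comp_samplePath_add_ae_eq [IsProbabilityMeasure P]
    (hexch : IsExchangeable X P) (hX : ∀ i, Measurable (X i)) {A : Set Y}
    {h : (ℕ → Y) → ℝ} (H : IsTailCondProb X P A h) {t : ℕ → I} (ht : t.Injective) (N : ℕ) :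
    h ∘ samplePath X (fun k => t (k + 1)) =ᵐ[P] h ∘ samplePath X (fun k => t (k + N + 1)) := by
  induction N with
  | zero => rfl
  | succ N ih =>
    have := hexch.comp_samplePath_succ_ae_eq hX H
      (t := fun k => t (k + N)) (ht.comp (add_left_injective N))
    simp only [add_right_comm _ _ N] at this
    exact ih.trans this

/-- The values of a tail conditional probability along two injective sequences of indices with a
common tail agree almost surely. -/
theorem IsExchangeable.comp_samplePath_ae_eq_of_eventually_eq [IsProbabilityMeasure P]
    (hexch : IsExchangeable X P) (hX : ∀ i, Measurable (X i)) {A : Set Y}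
    {h : (ℕ → Y) → ℝ} (H : IsTailCondProb X P A h) {s t : ℕ → I} (hs : s.Injective)
    (ht : t.Injective) {a b : ℕ} (hab : ∀ k, t (k + a + 1) = s (k + b + 1)) :
    h ∘ samplePath X (fun k => s (k + 1)) =ᵐ[P] h ∘ samplePath X (fun k => t (k + 1)) := by
  refine (hexch.comp_samplePath_add_ae_eq hX H hs b).trans ?_
  simp_rw [← hab]
  exact (hexch.comp_samplePath_add_ae_eq hX H ht a).symm

/-- The sequence of values of the functions `h m` at the observations along `t`, the first one
excluded. -/
def tailStatistic (X : I → Ω → Y) (h : ℕ → (ℕ → Y) → ℝ) (t : ℕ → I) (ω : Ω) : ℕ → ℝ :=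
  fun m => h m (samplePath X (fun k => t (k + 1)) ω)

variable {A : ℕ → Set Y} {h : ℕ → (ℕ → Y) → ℝ}

theorem measurable_tailStatistic (hX : ∀ i, Measurable (X i))
    (H : ∀ m, IsTailCondProb X P (A m) (h m)) (t : ℕ → I) : Measurable (tailStatistic X h t) :=
  measurable_pi_lambda _ fun m => (H m).measurable.comp (measurable_samplePath hX _)

theorem IsExchangeable.tailStatistic_ae_eq [IsProbabilityMeasure P]
    (hexch : IsExchangeable X P) (hX : ∀ i, Measurable (X i))
    (H : ∀ m, IsTailCondProb X P (A m) (h m)) {s t : ℕ → I} (hs : s.Injective)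
    (ht : t.Injective) {a b : ℕ} (hab : ∀ k, t (k + a + 1) = s (k + b + 1)) :
    tailStatistic X h s =ᵐ[P] tailStatistic X h t := by
  filter_upwards [ae_all_iff.mpr fun m =>
    hexch.comp_samplePath_ae_eq_of_eventually_eq hX (H m) hs ht hab] with ω hω
  exact funext hω

theorem IsExchangeable.isCondIdentDistribOver_tailStatistic [IsProbabilityMeasure P]
    (hexch : IsExchangeable X P) (hX : ∀ i, Measurable (X i))
    (H : ∀ m, IsTailCondProb X P (A m) (h m)) {s : ℕ → I} (hs : s.Injective) :
    IsCondIdentDistribOver (MeasurableSpace.comap (tailStatistic X h s) inferInstance) X P := by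
  rintro i j _ ⟨C, hC, rfl⟩ B hB
  have hH : Measurable fun (y : ℕ → Y) (m : ℕ) => h m fun k => y (k + 1) :=
    measurable_pi_lambda _ fun m => (H m).measurable.comp
      (measurable_pi_lambda _ fun k => measurable_pi_apply _)
  -- Along a path starting at `i`, both the statistic and the observation at `i` are fixed functions
  -- of that path.
  have key : ∀ i, ∃ t : ℕ → I, t.Injective ∧
      P (tailStatistic X h s ⁻¹' C ∩ X i ⁻¹' B) = P.map (samplePath X t)
        ((fun (y : ℕ → Y) (m : ℕ) => h m fun k => y (k + 1)) ⁻¹' C ∩ (fun y => y 0) ⁻¹' B) := by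
    intro i
    obtain ⟨t, ht, rfl, -, a, b, hab⟩ :=
      exists_injective_seq_starting_with hs (Finset.notMem_empty i)
    refine ⟨t, ht, ?_⟩
    rw [Measure.map_apply (measurable_samplePath hX t)
      ((hH hC).inter (measurable_pi_apply 0 hB))]
    have hae := hexch.tailStatistic_ae_eq hX H hs ht hab
    refine measure_congr (Filter.EventuallyEq.inter ?_ (ae_eq_refl _))
    exact hae.preimage C
  obtain ⟨t, ht, et⟩ := key i
  obtain ⟨t', ht', et'⟩ := key j
  rw [et, et', hexch.map_samplePath_eq hX ht ht']

/-- Along a sequence starting at `j` and meeting `J` later, `D ∩ G` is, up to a null set, an event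
of the later observations, where `h m` has the averaging property of a conditional probability. -/
theorem IsExchangeable.measureReal_inter_eq_setIntegral_tailStatistic [IsProbabilityMeasure P]
    (hexch : IsExchangeable X P) (hX : ∀ i, Measurable (X i)) (hA : ∀ m, MeasurableSet (A m))
    (H : ∀ m, IsTailCondProb X P (A m) (h m)) {s : ℕ → I} (hs : s.Injective)
    {j : I} {J : Finset I} (hj : j ∉ J) {D : Set Ω}
    (hD : MeasurableSet[⨆ i ∈ J, MeasurableSpace.comap (X i) inferInstance] D) {G : Set Ω}
    (hG : MeasurableSet[MeasurableSpace.comap (tailStatistic X h s) inferInstance] G) (m : ℕ) :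
    P.real (X j ⁻¹' A m ∩ (D ∩ G)) = ∫ ω in D ∩ G, tailStatistic X h s ω m ∂P := by
  obtain ⟨t, ht, rfl, hJ, a, b, hab⟩ := exists_injective_seq_starting_with hs hj
  obtain ⟨C, hC, rfl⟩ := hG
  have hae := hexch.tailStatistic_ae_eq hX H hs ht hab
  have hm := measurable_samplePath hX fun k => t (k + 1)
  have hD' : MeasurableSet[MeasurableSpace.comap (samplePath X fun k => t (k + 1)) inferInstance]
      D := by
    refine (iSup₂_le fun i hi => ?_ : (⨆ i ∈ J, MeasurableSpace.comap (X i) inferInstance) ≤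
      MeasurableSpace.comap (samplePath X fun k => t (k + 1)) inferInstance) D hD
    obtain ⟨k, rfl⟩ := hJ i hi
    exact ((measurable_pi_apply k).comp
      (comap_measurable (samplePath X fun k => t (k + 1)))).comap_le
  have hH : Measurable fun (y : ℕ → Y) (m : ℕ) => h m y :=
    measurable_pi_lambda _ fun m => (H m).measurable
  have hG' : MeasurableSet[MeasurableSpace.comap (samplePath X fun k => t (k + 1)) inferInstance]
      (tailStatistic X h t ⁻¹' C) := ⟨_, hH hC, rfl⟩
  have hDG := hD'.inter hG'
  have hset : (D ∩ tailStatistic X h s ⁻¹' C : Set Ω) =ᵐ[P] (D ∩ tailStatistic X h t ⁻¹' C : Set Ω) :=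
    Filter.EventuallyEq.inter (ae_eq_refl _) (hae.preimage C)
  have hset' : (X (t 0) ⁻¹' A m ∩ (D ∩ tailStatistic X h s ⁻¹' C) : Set Ω) =ᵐ[P]
      (X (t 0) ⁻¹' A m ∩ (D ∩ tailStatistic X h t ⁻¹' C) : Set Ω) :=
    Filter.EventuallyEq.inter (ae_eq_refl _) hset
  rw [setIntegral_congr_set hset, measureReal_congr hset',
    ← setIntegral_indicator_one_eq_measureReal (hX _ (hA m)),
    ← setIntegral_condExp hm.comap_le ((integrable_const 1).indicator (hX _ (hA m))) hDG]
  refine setIntegral_congr_ae (hm.comap_le _ hDG) ?_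
  filter_upwards [hae, (H m).ae_eq t ht] with ω h₁ h₂ _
  rw [h₁, ← h₂]
  rfl

theorem IsExchangeable.condExp_inter_preimage_ae_eq_mul_tailStatistic [IsProbabilityMeasure P]
    (hexch : IsExchangeable X P) (hX : ∀ i, Measurable (X i)) (hA : ∀ m, MeasurableSet (A m))
    (H : ∀ m, IsTailCondProb X P (A m) (h m)) {s : ℕ → I} (hs : s.Injective)
    {j : I} {J : Finset I} (hj : j ∉ J) {D : Set Ω}
    (hD : MeasurableSet[⨆ i ∈ J, MeasurableSpace.comap (X i) inferInstance] D) (m : ℕ) :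
    P⟦D ∩ X j ⁻¹' A m | MeasurableSpace.comap (tailStatistic X h s) inferInstance⟧ =ᵐ[P]
      P⟦D | MeasurableSpace.comap (tailStatistic X h s) inferInstance⟧ *
        fun ω => tailStatistic X h s ω m := by
  have hF := (measurable_tailStatistic hX H s).comap_le
  have hD' : MeasurableSet D := (iSup₂_le fun i _ => (hX i).comap_le :
    (⨆ i ∈ J, MeasurableSpace.comap (X i) inferInstance) ≤ _) D hD
  have hind : ∀ {S : Set Ω}, MeasurableSet S → Integrable (S.indicator fun _ => (1 : ℝ)) P :=
    fun hS => (integrable_const 1).indicator hS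
  have hV : StronglyMeasurable[MeasurableSpace.comap (tailStatistic X h s) inferInstance]
      fun ω => tailStatistic X h s ω m :=
    ((measurable_pi_apply m).comp (comap_measurable (tailStatistic X h s))).stronglyMeasurable
  have hVint : Integrable (fun ω => tailStatistic X h s ω m) P := (H m).integrable_comp hX _
  have hDV : Integrable (D.indicator (fun _ => (1 : ℝ)) * fun ω => tailStatistic X h s ω m) P :=
    hVint.bdd_mul (c := 1) (hind hD').aestronglyMeasurable
      (ae_of_all _ fun ω => (norm_indicator_le_norm_self _ ω).trans (by simp))
  refine Filter.EventuallyEq.trans (Filter.EventuallyEq.symm ?_)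
    (condExp_mul_of_stronglyMeasurable_right hV hDV (hind hD'))
  refine ae_eq_condExp_of_forall_setIntegral_eq hF (hind (hD'.inter (hX j (hA m))))
    (fun _ _ _ => integrable_condExp.integrableOn) (fun G hG _ => ?_)
    stronglyMeasurable_condExp.aestronglyMeasurable
  rw [setIntegral_condExp hF hDV hG,
    setIntegral_indicator_one_eq_measureReal (hD'.inter (hX j (hA m))), Set.inter_comm D,
    Set.inter_assoc,
    hexch.measureReal_inter_eq_setIntegral_tailStatistic hX hA H hs hj hD hG m, Set.inter_comm,
    ← setIntegral_indicator hD']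
  congr 1
  ext ω
  by_cases hω : ω ∈ D <;> simp [hω]

/-- Given the tail statistic of a generating π-system, an observation is conditionally independent
of any finitely many other ones. -/
theorem IsExchangeable.condExp_inter_preimage_ae_eq_mul [IsProbabilityMeasure P]
    (hexch : IsExchangeable X P) (hX : ∀ i, Measurable (X i))
    (hgen : ‹MeasurableSpace Y› = MeasurableSpace.generateFrom (Set.range A))
    (hpi : IsPiSystem (Set.range A)) (huniv : Set.univ ∈ Set.range A)
    (H : ∀ m, IsTailCondProb X P (A m) (h m)) {s : ℕ → I} (hs : s.Injective)
    {j : I} {J : Finset I} (hj : j ∉ J) {D : Set Ω}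
    (hD : MeasurableSet[⨆ i ∈ J, MeasurableSpace.comap (X i) inferInstance] D) {B : Set Y}
    (hB : MeasurableSet B) :
    P⟦D ∩ X j ⁻¹' B | MeasurableSpace.comap (tailStatistic X h s) inferInstance⟧ =ᵐ[P]
      P⟦D | MeasurableSpace.comap (tailStatistic X h s) inferInstance⟧ *
        P⟦X j ⁻¹' B | MeasurableSpace.comap (tailStatistic X h s) inferInstance⟧ := by
  have hA : ∀ m, MeasurableSet (A m) := fun m => by
    rw [hgen]
    exact MeasurableSpace.measurableSet_generateFrom ⟨m, rfl⟩
  have hF := (measurable_tailStatistic hX H s).comap_le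
  have hD' : MeasurableSet D := (iSup₂_le fun i _ => (hX i).comap_le :
    (⨆ i ∈ J, MeasurableSpace.comap (X i) inferInstance) ≤ _) D hD
  rw [condExp_indicator_inter_ae_eq_mul_iff hF hD' (hX j hB)]
  intro G hG
  refine setIntegral_preimage_eq_zero_of_generateFrom (hX j)
    (((integrable_const 1).indicator hD').sub integrable_condExp) (hF _ hG) hgen hpi huniv ?_ hB
  rintro _ ⟨m, rfl⟩
  refine (condExp_indicator_inter_ae_eq_mul_iff hF hD' (hX j (hA m))).mp ?_ G hG
  have h₁ := hexch.condExp_inter_preimage_ae_eq_mul_tailStatistic hX hA H hs hj hD m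
  -- The case of empty `J` and D = Ω identifies coordinate `m` of the statistic with the conditional
  -- probability of `X j ⁻¹' A m`.
  have h₂ := hexch.condExp_inter_preimage_ae_eq_mul_tailStatistic hX hA H hs
    (Finset.notMem_empty j) MeasurableSet.univ m
  rw [Set.univ_inter, Set.indicator_univ, condExp_const hF] at h₂
  filter_upwards [h₁, h₂] with ω h₁ h₂
  rw [h₁, Pi.mul_apply, Pi.mul_apply, h₂]
  simp

theorem IsExchangeable.isCondIndepFunOver_tailStatistic [IsProbabilityMeasure P]
    (hexch : IsExchangeable X P) (hX : ∀ i, Measurable (X i))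
    (hgen : ‹MeasurableSpace Y› = MeasurableSpace.generateFrom (Set.range A))
    (hpi : IsPiSystem (Set.range A)) (huniv : Set.univ ∈ Set.range A)
    (H : ∀ m, IsTailCondProb X P (A m) (h m)) {s : ℕ → I} (hs : s.Injective) :
    IsCondIndepFunOver (MeasurableSpace.comap (tailStatistic X h s) inferInstance) X P := by
  classical
  intro n _ i hi E hE
  have hF := (measurable_tailStatistic hX H s).comap_le
  suffices hS : ∀ S : Finset (Fin n),
      P⟦⋂ j ∈ S, E j | MeasurableSpace.comap (tailStatistic X h s) inferInstance⟧ =ᵐ[P]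
        ∏ j ∈ S, P⟦E j | MeasurableSpace.comap (tailStatistic X h s) inferInstance⟧ by
    simpa using hS Finset.univ
  intro S
  induction S using Finset.induction_on with
  | empty =>
    simp only [Finset.notMem_empty, Set.iInter_of_empty, Set.iInter_univ, Set.indicator_univ,
      Finset.prod_empty]
    rw [condExp_const hF]
    rfl
  | insert k S hk ih =>
    obtain ⟨B, hB, hBE⟩ := hE k
    have hD : MeasurableSet[⨆ l ∈ S.image i, MeasurableSpace.comap (X l) inferInstance]
        (⋂ j ∈ S, E j) :=
      MeasurableSet.biInter S.countable_toSet fun j hj =>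
        le_iSup₂_of_le (f := fun l (_ : l ∈ S.image i) => MeasurableSpace.comap (X l) inferInstance)
          (i j) (Finset.mem_image_of_mem i hj) le_rfl _ (hE j)
    have hkS : i k ∉ S.image i := fun hmem => by
      obtain ⟨l, hl, hlk⟩ := Finset.mem_image.mp hmem
      exact hk (hi hlk ▸ hl)
    have := hexch.condExp_inter_preimage_ae_eq_mul hX hgen hpi huniv H hs hkS hD hB
    rw [hBE] at this
    rw [Finset.set_biInter_insert, Finset.prod_insert hk, Set.inter_comm, mul_comm]
    exact this.trans (ih.mul (ae_eq_refl _))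

end TailStatistic

/-! ### Countable generation and encoding into a random vector. -/

/-- The set algebra generated by a countable generating family is still countable. -/
theorem exists_seq_isPiSystem_generateFrom_range (Y : Type*) [mY : MeasurableSpace Y]
    [MeasurableSpace.CountablyGenerated Y] :
    ∃ A : ℕ → Set Y, mY = MeasurableSpace.generateFrom (Set.range A) ∧
      IsPiSystem (Set.range A) ∧ Set.univ ∈ Set.range A := by
  have halg := isSetAlgebra_generateSetAlgebra (𝒜 := MeasurableSpace.countableGeneratingSet Y)
  obtain ⟨A, hA⟩ := (countable_generateSetAlgebra
    (MeasurableSpace.countable_countableGeneratingSet (α := Y))).exists_eq_range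
    ⟨_, halg.empty_mem⟩
  refine ⟨A, ?_, ?_, ?_⟩ <;> rw [← hA]
  · rw [generateFrom_generateSetAlgebra_eq, MeasurableSpace.generateFrom_countableGeneratingSet]
  · exact fun s hs t ht _ => halg.inter_mem hs ht
  · exact halg.univ_mem

/-- The σ-algebra generated by a map into a standard Borel space is generated by a random vector of
any positive dimension. -/
theorem exists_measurable_euclideanSpace_comap_eq {Ω S : Type*} [MeasurableSpace Ω]
    [mS : MeasurableSpace S] [StandardBorelSpace S] {Z : Ω → S} (hZ : Measurable Z) {d : ℕ}
    (hd : 1 ≤ d) :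
    ∃ Θ : Ω → EuclideanSpace ℝ (Fin d), Measurable Θ ∧
      MeasurableSpace.comap Θ inferInstance = mS.comap Z := by
  -- A real embedding repeated in all coordinates; since d ≥ 1, coordinate 0 recovers it.
  let e : S → EuclideanSpace ℝ (Fin d) := fun z => WithLp.toLp 2 fun _ => embeddingReal S z
  have he : Measurable e := (WithLp.measurable_toLp 2 _).comp
    (measurable_pi_lambda _ fun _ => measurable_embeddingReal S)
  refine ⟨e ∘ Z, he.comp hZ, ?_⟩
  rw [← MeasurableSpace.comap_comp]
  congr 1
  refine le_antisymm he.comap_le ?_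
  have hproj : Measurable fun x : EuclideanSpace ℝ (Fin d) => x ⟨0, hd⟩ :=
    (measurable_pi_apply _).comp (WithLp.measurable_ofLp 2 _)
  rw [← (measurableEmbedding_embeddingReal S).comap_eq]
  exact (hproj.comp (comap_measurable e)).comap_le

theorem proposition4 {Ω Y I : Type*} [MeasurableSpace Ω] [MeasurableSpace Y]
    [MeasurableSpace.CountablyGenerated Y] [Infinite I]
    (P : Measure Ω) [IsProbabilityMeasure P]
    (X : I → Ω → Y) (hX : ∀ i, Measurable (X i))
    (hperf : ∀ i, IsPerfectMeasure (P.map (X i)))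
    (hexch : IsExchangeable X P)
    (d : ℕ) (hd : 1 ≤ d) :
    ∃ Θ : Ω → EuclideanSpace ℝ (Fin d), Measurable Θ ∧ IsCondIIDGiven Θ X P := by
  obtain ⟨A, hgen, hpi, huniv⟩ := exists_seq_isPiSystem_generateFrom_range Y
  have hA : ∀ m, MeasurableSet (A m) := fun m => by
    rw [hgen]
    exact MeasurableSpace.measurableSet_generateFrom ⟨m, rfl⟩
  choose h H using fun m => hexch.exists_condExp_eq_comp_samplePath hX (hA m)
  have hs := (Infinite.natEmbedding I).injective
  obtain ⟨Θ, hΘ, hcomap⟩ :=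
    exists_measurable_euclideanSpace_comap_eq (measurable_tailStatistic hX H _) hd
  refine ⟨Θ, hΘ, ?_⟩
  rw [IsCondIIDGiven, hcomap]
  exact ⟨hexch.isCondIndepFunOver_tailStatistic hX hgen hpi huniv H hs,
    hexch.isCondIdentDistribOver_tailStatistic hX H hs⟩
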